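/- Let $G$ be a compact (Hausdorff) topological group and $H\subseteq G$ a closed subgroup such that $(G,H)$ is a Gelfand pair, i.e. in every continuous finite-dimensional irreducible complex representation of $G$ the $H$-invariant vectors form a subspace of dimension at most $1$. Let $X=G/H$. A *probabilistic structure* of $(G,H)$ is a nonempty set $\mathcal F$ of continuous functions $\mathbf f:X\to[0,1]$ (outcome probability functions) which is convex, is closed under $\mathbf f\mapsto \mathbf f\circ g$ for $g\in G$ and under $\mathbf f\mapsto \mathbf u-\mathbf f$ (where $\mathbf u\equiv 1$), contains $\mathbf f_i+\mathbf f_j$ whenever $i\neq j$ and $\mathbf f_1,\dots,\mathbf f_n\in\mathcal F$ satisfy $\sum_k\mathbf f_k=\mathbf u$, and whose real linear span $\mathbb R[\mathcal F]$ is finite-dimensional. Its associated representation is the representation of $G$ on $V=\mathbb R[\mathcal F]^*$ given by $(\Gamma_g\omega)(\mathbf f)=\omega(\mathbf f\circ g)$, and the pure states are $\Omega_x\in V$, $\Omega_x(\mathbf f)=\mathbf f(x)$, for $x\in X$. The structure $\mathcal F$ is *unrestricted* if for every linear functional $\Lambda:V\to\mathbb R$ with $\Lambda(\Omega_x)\in[0,1]$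 for all $x\in X$, the function $x\mapsto\Lambda(\Omega_x)$ belongs to $\mathcal F$. For two probabilistic structures put $$D(\mathcal F^0,\mathcal F^1)=\sup_{\mathbf f^0\in\mathcal F^0}\ \inf_{\mathbf f^1\in\mathcal F^1}\ \sup_{x\in X}|\mathbf f^0(x)-\mathbf f^1(x)| .$$ **Theorem.** Let $\mathcal F^0$ and $\mathcal F^1$ be two unrestricted probabilistic structures of $(G,H)$. If some real irreducible representation of $G$, of real dimension $d^0$, is equivalent to a subrepresentation of the representation associated to $\mathcal F^0$ but to no subrepresentation of the representation associated to $\mathcal F^1$, then $$D(\mathcal F^0,\mathcal F^1)\ \ge\ \frac1{4d^0}.$$ -/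

import Mathlib

/-- A complex representation of a topological group is continuous when all its matrix coefficients
are. For a finite-dimensional `V` this is continuity of `G → GL(V)`. -/
def IsContinuousRep {G V : Type*} [Group G] [TopologicalSpace G] [AddCommGroup V] [Module ℂ V]
    (ρ : Representation ℂ G V) : Prop :=
  ∀ (v : V) (l : Module.Dual ℂ V), Continuous fun g : G => l (ρ g v)

/-- `(G, H)` is a Gelfand pair: in every (continuous, finite-dimensional) irreducible complex
representation of `G`, the `H`-invariant vectors form a subspace of dimension at most one. -/
def IsGelfandPair (G : Type*) [Group G] [TopologicalSpace G] (H : Subgroup G) : Prop :=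
  ∀ (V : Type) [AddCommGroup V] [Module ℂ V] [FiniteDimensional ℂ V] (ρ : Representation ℂ G V),
    IsContinuousRep ρ → ρ.IsIrreducible →
      Module.finrank ℂ (Representation.invariants (ρ.comp H.subtype)) ≤ 1

/-- A probabilistic structure of the dynamical structure `(X, G)`: a set of outcome probability
functions (OPFs) on the pure states `X`. A measurement is any finite family of OPFs that sums to
the unit OPF. The last two fields are the conventions that mixed states live in a
finite-dimensional space and that the embedding of the pure states in it is continuous. -/
structure ProbabilisticStructure (G X : Type*) [Group G] [MulAction G X]
    [TopologicalSpace X] where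
  opf : Set (X → ℝ)
  nonempty : opf.Nonempty
  mem_Icc : ∀ f ∈ opf, ∀ x, f x ∈ Set.Icc (0 : ℝ) 1
  mixture : Convex ℝ opf
  comp_smul : ∀ f ∈ opf, ∀ g : G, (fun x => f (g • x)) ∈ opf
  coarse_graining : ∀ (n : ℕ) (f : Fin n → X → ℝ), (∀ i, f i ∈ opf) → ∑ i, f i = 1 →
    ∀ i j, i ≠ j → f i + f j ∈ opf
  complement : ∀ f ∈ opf, 1 - f ∈ opf
  finiteDimensional : FiniteDimensional ℝ (Submodule.span ℝ opf)
  continuous : ∀ f ∈ opf, Continuous f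

namespace ProbabilisticStructure

variable {G X : Type*} [Group G] [MulAction G X] [TopologicalSpace X]

/-- The real vector space `ℝ[F]` spanned by the OPFs. -/
abbrev opfSpace (F : ProbabilisticStructure G X) : Submodule ℝ (X → ℝ) :=
  Submodule.span ℝ F.opf

/-- The space `V = ℝ[F]*` in which the states live. -/
abbrev stateSpace (F : ProbabilisticStructure G X) : Type _ :=
  Module.Dual ℝ F.opfSpace

/-- The pure state `Ω x`, i.e. evaluation of OPFs at `x`. -/
def pureState (F : ProbabilisticStructure G X) (x : X) : F.stateSpace :=
  (LinearMap.proj x).comp F.opfSpace.subtype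

theorem comp_smul_mem_opfSpace (F : ProbabilisticStructure G X) (g : G) {f : X → ℝ}
    (hf : f ∈ F.opfSpace) : LinearMap.funLeft ℝ ℝ (fun x : X => g • x) f ∈ F.opfSpace := by
  have h : F.opfSpace ≤ F.opfSpace.comap (LinearMap.funLeft ℝ ℝ (fun x : X => g • x)) :=
    Submodule.span_le.2 fun f hf => Submodule.subset_span (F.comp_smul f hf g)
  exact h hf

/-- The action `(g f)(x) = f (g⁻¹ x)` of `G` on `ℝ[F]`. -/
def opfRep (F : ProbabilisticStructure G X) : Representation ℝ G F.opfSpace where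
  toFun g := (LinearMap.funLeft ℝ ℝ (fun x : X => g⁻¹ • x)).restrict
    fun _ hf => F.comp_smul_mem_opfSpace g⁻¹ hf
  map_one' := by
    ext f x
    simp [LinearMap.funLeft_apply]
  map_mul' g h := by
    ext f x
    simp [LinearMap.funLeft_apply, mul_smul]

/-- The representation `Γ` of `G` on `V = ℝ[F]*` associated to `F`,
`(Γ g ω)(f) = ω (f ∘ g)`. -/
def assocRep (F : ProbabilisticStructure G X) : Representation ℝ G F.stateSpace :=
  F.opfRep.dual

theorem assocRep_pureState (F : ProbabilisticStructure G X) (g : G) (x : X) :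
    F.assocRep g (F.pureState x) = F.pureState (g • x) := by
  ext f
  change (f : X → ℝ) (g⁻¹⁻¹ • x) = (f : X → ℝ) (g • x)
  rw [inv_inv]

/-- `F` is unrestricted: every linear functional on `V` that takes values in `[0,1]` on the pure
states gives an OPF of `F`. -/
def IsUnrestricted (F : ProbabilisticStructure G X) : Prop :=
  ∀ L : Module.Dual ℝ F.stateSpace, (∀ x, L (F.pureState x) ∈ Set.Icc (0 : ℝ) 1) →
    (fun x => L (F.pureState x)) ∈ F.opf

/-- The real representation `σ` appears in `F`: it is equivalent to a subrepresentation of the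
associated representation of `F`. -/
def Contains (F : ProbabilisticStructure G X) {W : Type*} [AddCommGroup W] [Module ℝ W]
    (σ : Representation ℝ G W) : Prop :=
  ∃ T : Representation.IntertwiningMap σ F.assocRep, Function.Injective T

end ProbabilisticStructure

/-- The distance `sup_x |f₀ x - f₁ x|` between two OPFs. -/
noncomputable def opfDist {X : Type*} (f₀ f₁ : X → ℝ) : ℝ :=
  ⨆ x, |f₀ x - f₁ x|

/-- The operational distance `D(F₀, F₁) = sup_{f₀ ∈ F₀} inf_{f₁ ∈ F₁} dist(f₀, f₁)`. The OPF sets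
are nonempty and all quantities lie in `[0,1]` (see the two bounds below), so that the suprema and
infima are the genuine ones. -/
noncomputable def operationalDist {G X : Type*} [Group G] [MulAction G X] [TopologicalSpace X]
    (F₀ F₁ : ProbabilisticStructure G X) : ℝ :=
  ⨆ f₀ : F₀.opf, ⨅ f₁ : F₁.opf, opfDist (f₀ : X → ℝ) (f₁ : X → ℝ)

theorem abs_opf_sub_le_one {G X : Type*} [Group G] [MulAction G X] [TopologicalSpace X]
    (F₀ F₁ : ProbabilisticStructure G X) (f₀ : F₀.opf) (f₁ : F₁.opf) (x : X) :
    |(f₀ : X → ℝ) x - (f₁ : X → ℝ) x| ≤ 1 := by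
  have h₀ := F₀.mem_Icc _ f₀.2 x
  have h₁ := F₁.mem_Icc _ f₁.2 x
  rw [abs_le]
  constructor <;> linarith [h₀.1, h₀.2, h₁.1, h₁.2]

theorem iInf_opfDist_mem_Icc {G X : Type*} [Group G] [MulAction G X] [TopologicalSpace X]
    (F₀ F₁ : ProbabilisticStructure G X) (f₀ : F₀.opf) :
    (⨅ f₁ : F₁.opf, opfDist (f₀ : X → ℝ) (f₁ : X → ℝ)) ∈ Set.Icc (0 : ℝ) 1 := by
  have h0 : ∀ f₁ : F₁.opf, 0 ≤ opfDist (f₀ : X → ℝ) (f₁ : X → ℝ) := fun f₁ =>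
    Real.iSup_nonneg fun x => abs_nonneg _
  obtain ⟨f, hf⟩ := F₁.nonempty
  refine ⟨Real.iInf_nonneg h0, ?_⟩
  refine (ciInf_le ⟨0, ?_⟩ (⟨f, hf⟩ : F₁.opf)).trans ?_
  · rintro _ ⟨f₁, rfl⟩
    exact h0 f₁
  · exact Real.iSup_le (fun x => abs_opf_sub_le_one F₀ F₁ f₀ ⟨f, hf⟩ x) zero_le_one

/-! Separate the two structures by a test function. Pull functions on `G ⧸ H` back to `G` and use
the `L²` pairing of Haar probability. It makes `ℝ[F₀]` self-dual, so `W`, of dimension `d`, embeds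
in it as functions; by Schur these are orthogonal to `ℝ[F₁]`, hence also to constants. The
reproducing kernel `κ` of `W` at `1` satisfies `⟨κ, κ⟩ = d` and `|κ| ≤ d`. Put `φ = κ / d` and `f₀ =
(1 + φ) / 2`, an OPF of `F₀` because `F₀` is unrestricted. For every OPF `f₁` of `F₁`, `⟨φ, f₀ - f₁⟩
= ⟨φ, φ⟩ / 2 = 1 / (2 d)`, while `|φ| ≤ 1` bounds this pairing by `sup |f₀ - f₁|`. -/

open MeasureTheory

/-! ### The invariant `L²` pairing and reproducing kernels -/

section HaarPairing

variable {G : Type*} [TopologicalSpace G] [CompactSpace G] [MeasurableSpace G]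
  [BorelSpace G]

theorem ContinuousMap.integrable_of_isFiniteMeasure (μ : Measure G) [IsFiniteMeasure μ]
    (f : C(G, ℝ)) : Integrable f μ :=
  Integrable.of_bound f.continuous.aestronglyMeasurable ‖f‖
    (Filter.Eventually.of_forall f.norm_coe_le_norm)

/-- The `L²` pairing `∫ f h ∂μ` of continuous functions on a compact space. -/
noncomputable def integralPairing (μ : Measure G) [IsFiniteMeasure μ] :
    C(G, ℝ) →ₗ[ℝ] C(G, ℝ) →ₗ[ℝ] ℝ :=
  LinearMap.mk₂ ℝ (fun f h => ∫ x, (f * h) x ∂μ)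
    (fun f f' h => by
      rw [add_mul]
      exact integral_add ((f * h).integrable_of_isFiniteMeasure μ)
        ((f' * h).integrable_of_isFiniteMeasure μ))
    (fun c f h => by
      rw [smul_mul_assoc]
      exact integral_smul c _)
    (fun f h h' => by
      rw [mul_add]
      exact integral_add ((f * h).integrable_of_isFiniteMeasure μ)
        ((f * h').integrable_of_isFiniteMeasure μ))
    (fun c f h => by
      rw [mul_smul_comm]
      exact integral_smul c _)

variable (μ : Measure G) [IsFiniteMeasure μ]

theorem integralPairing_apply (f h : C(G, ℝ)) :
    integralPairing μ f h = ∫ x, f x * h x ∂μ := rfl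

theorem integralPairing_comm (f h : C(G, ℝ)) :
    integralPairing μ f h = integralPairing μ h f := by
  simp only [integralPairing_apply, mul_comm]

theorem integralPairing_self_nonneg (f : C(G, ℝ)) : 0 ≤ integralPairing μ f f :=
  integral_nonneg fun x => mul_self_nonneg (f x)

theorem eq_zero_of_integralPairing_self [μ.IsOpenPosMeasure] {f : C(G, ℝ)}
    (h : integralPairing μ f f = 0) : f = 0 := by
  have h' := (integral_eq_zero_iff_of_nonneg (fun x => mul_self_nonneg (f x))
    ((f * f).integrable_of_isFiniteMeasure μ)).1 h
  have := (Continuous.ae_eq_iff_eq μ (f * f).continuous continuous_const).1 h'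
  ext x
  exact mul_self_eq_zero.1 (congrFun this x)

/-- Turns a pairing with a test function bounded by `1` into a lower bound on a sup distance. -/
theorem integralPairing_le [IsProbabilityMeasure μ] {f h : C(G, ℝ)} {s : ℝ}
    (hf : ∀ x, |f x| ≤ 1) (hh : ∀ x, |h x| ≤ s) : integralPairing μ f h ≤ s := by
  have : ∫ x, (f * h) x ∂μ ≤ ∫ _, s ∂μ :=
    integral_mono ((f * h).integrable_of_isFiniteMeasure μ) (integrable_const s) fun x => by
      calc f x * h x ≤ |f x| * |h x| := by rw [← abs_mul]; exact le_abs_self _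
        _ ≤ 1 * s := mul_le_mul (hf x) (hh x) (abs_nonneg _) zero_le_one
        _ = s := one_mul s
  simpa [integralPairing_apply] using this

variable [Group G] [IsTopologicalGroup G] [μ.IsMulLeftInvariant]

theorem integralPairing_translate {f f' h h' : C(G, ℝ)} (g : G)
    (hf : ∀ x, f' x = f (g⁻¹ * x)) (hh : ∀ x, h' x = h (g⁻¹ * x)) :
    integralPairing μ f' h' = integralPairing μ f h := by
  simp only [integralPairing_apply, hf, hh]
  exact integral_mul_left_eq_self (fun x => f x * h x) g⁻¹

/-- A finite-dimensional translation-invariant space `W` of continuous functions on a compact group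
contains its reproducing kernel `κ` at the identity, and `κ 1 = ‖κ‖² = dim W` bounds `|κ|`. -/
theorem exists_reproducing_kernel [μ.IsOpenPosMeasure] [IsProbabilityMeasure μ]
    {W : Type*} [AddCommGroup W] [Module ℝ W] [FiniteDimensional ℝ W] (σ : Representation ℝ G W)
    (A : W →ₗ[ℝ] C(G, ℝ)) (hinj : Function.Injective A)
    (hA : ∀ g w x, A (σ g w) x = A w (g⁻¹ * x)) :
    ∃ κ : W, integralPairing μ (A κ) (A κ) = Module.finrank ℝ W ∧
      ∀ x, |A κ x| ≤ Module.finrank ℝ W := by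
  let core : InnerProductSpace.Core ℝ W :=
    { inner := fun v w => integralPairing μ (A v) (A w)
      conj_inner_symm := fun v w => integralPairing_comm μ _ _
      re_inner_nonneg := fun v => integralPairing_self_nonneg μ _
      add_left := fun u v w => by simp
      smul_left := fun u v c => by simp
      definite := fun v hv =>
        hinj (by rw [eq_zero_of_integralPairing_self μ hv, map_zero]) }
  let : NormedAddCommGroup W := core.toNormedAddCommGroup
  let : InnerProductSpace ℝ W := InnerProductSpace.ofCore core.toCore
  have inner_def : ∀ v w : W, inner ℝ v w = integralPairing μ (A v) (A w) := fun _ _ => rfl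
  have inner_rep : ∀ g v w, inner ℝ (σ g v) (σ g w) = inner ℝ v w := fun g v w => by
    simp only [inner_def]
    exact integralPairing_translate μ g (hA g v) (hA g w)
  let b := stdOrthonormalBasis ℝ W
  -- The Riesz representative of evaluation at `1`; by invariance `σ g κ` represents evaluation at
  -- `g`.
  let κ : W := ∑ i, A (b i) 1 • b i
  have inner_kernel_one : ∀ v, inner ℝ κ v = A v 1 := fun v => by
    conv_rhs => rw [← b.sum_repr v]
    simp only [κ, sum_inner, inner_smul_left, map_sum, map_smul, ContinuousMap.sum_apply,
      ContinuousMap.smul_apply, b.repr_apply_apply, smul_eq_mul]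
    exact Finset.sum_congr rfl fun i _ => by simp [mul_comm]
  have inner_kernel : ∀ g v, inner ℝ (σ g κ) v = A v g := fun g v => by
    have h := inner_rep g κ (σ g⁻¹ v)
    rw [inner_kernel_one, hA, Representation.self_inv_apply] at h
    simpa using h
  have norm_kernel : ∀ g, ‖σ g κ‖ = ‖κ‖ := fun g => by
    rw [norm_eq_sqrt_real_inner, norm_eq_sqrt_real_inner, inner_rep]
  -- Parseval for `σ g κ`: the sum is constant in `g`, so integrating it counts the basis vectors.
  have sum_sq : ∀ g, ∑ i, A (b i) g * A (b i) g = inner ℝ κ κ := fun g => by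
    rw [← inner_rep g, ← b.sum_inner_mul_inner]
    exact Finset.sum_congr rfl fun i _ => by
      rw [real_inner_comm (σ g κ) (b i), inner_kernel]
  have norm_sq : inner ℝ κ κ = (Module.finrank ℝ W : ℝ) := by
    have h : ∫ g, ∑ i, A (b i) g * A (b i) g ∂μ = inner ℝ κ κ := by simp [sum_sq]
    have hint : ∀ i ∈ Finset.univ, Integrable (fun g => A (b i) g * A (b i) g) μ := fun i _ =>
      (A (b i) * A (b i)).integrable_of_isFiniteMeasure μ
    rw [← h, integral_finsetSum _ hint]
    have : ∀ i, ∫ g, A (b i) g * A (b i) g ∂μ = 1 := fun i => by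
      rw [← integralPairing_apply, ← inner_def, real_inner_self_eq_norm_sq, b.norm_eq_one,
        one_pow]
    simp [this]
  refine ⟨κ, norm_sq, fun x => ?_⟩
  -- `A κ x = ⟨σ x κ, κ⟩`, and both vectors have the norm of `κ`: Cauchy–Schwarz.
  rw [← inner_kernel, ← norm_sq, real_inner_self_eq_norm_mul_norm]
  nth_rewrite 1 [← norm_kernel x]
  exact abs_real_inner_le_norm _ _

end HaarPairing

/-! ### OPF spaces as function spaces on the group -/

namespace ProbabilisticStructure

section

variable {G X : Type*} [Group G] [MulAction G X] [TopologicalSpace X]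

theorem one_mem_opfSpace (F : ProbabilisticStructure G X) : (1 : X → ℝ) ∈ F.opfSpace := by
  obtain ⟨f, hf⟩ := F.nonempty
  simpa using add_mem (Submodule.subset_span hf) (Submodule.subset_span (F.complement f hf))

theorem continuous_of_mem_opfSpace (F : ProbabilisticStructure G X) {f : X → ℝ}
    (hf : f ∈ F.opfSpace) : Continuous f := by
  induction hf using Submodule.span_induction with
  | mem f hf => exact F.continuous f hf
  | zero => exact continuous_const
  | add f h _ _ hf hh => exact hf.add hh
  | smul c f _ hf => exact continuous_const.mul hf

theorem IsUnrestricted.mem_opf {F : ProbabilisticStructure G X} (hF : F.IsUnrestricted)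
    {f : X → ℝ} (hf : f ∈ F.opfSpace) (h : ∀ x, f x ∈ Set.Icc (0 : ℝ) 1) : f ∈ F.opf :=
  hF (Module.Dual.eval ℝ F.opfSpace ⟨f, hf⟩) h

theorem bddAbove_opfDist (F₀ F₁ : ProbabilisticStructure G X) {f₀ f₁ : X → ℝ}
    (h₀ : f₀ ∈ F₀.opf) (h₁ : f₁ ∈ F₁.opf) :
    BddAbove (Set.range fun x => |f₀ x - f₁ x|) :=
  ⟨1, Set.forall_mem_range.2 fun x => abs_opf_sub_le_one F₀ F₁ ⟨f₀, h₀⟩ ⟨f₁, h₁⟩ x⟩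

theorem le_operationalDist {F₀ F₁ : ProbabilisticStructure G X} {f₀ : X → ℝ}
    (h₀ : f₀ ∈ F₀.opf) {c : ℝ} (hc : ∀ f₁ ∈ F₁.opf, c ≤ opfDist f₀ f₁) :
    c ≤ operationalDist F₀ F₁ := by
  have : Nonempty F₁.opf := F₁.nonempty.to_subtype
  exact (le_ciInf fun f₁ : F₁.opf => hc f₁ f₁.2).trans
    (le_ciSup (f := fun f₀ : F₀.opf => ⨅ f₁ : F₁.opf, opfDist (f₀ : X → ℝ) (f₁ : X → ℝ))
      ⟨1, Set.forall_mem_range.2 fun f => (iInf_opfDist_mem_Icc F₀ F₁ f).2⟩ ⟨f₀, h₀⟩)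

end

variable {G : Type*} [Group G] [TopologicalSpace G] {H : Subgroup G}

/-- Functions in `ℝ[F]`, viewed as continuous functions on the group. -/
def toGroupFunction (F : ProbabilisticStructure G (G ⧸ H)) : F.opfSpace →ₗ[ℝ] C(G, ℝ) where
  toFun f := ⟨fun g => (f : G ⧸ H → ℝ) g,
    (F.continuous_of_mem_opfSpace f.2).comp continuous_quot_mk⟩
  map_add' _ _ := rfl
  map_smul' _ _ := rfl

theorem toGroupFunction_apply (F : ProbabilisticStructure G (G ⧸ H)) (f : F.opfSpace) (g : G) :
    F.toGroupFunction f g = (f : G ⧸ H → ℝ) g := rfl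

theorem toGroupFunction_injective (F : ProbabilisticStructure G (G ⧸ H)) :
    Function.Injective F.toGroupFunction := fun f h hfh => by
  ext x
  obtain ⟨g, rfl⟩ := QuotientGroup.mk_surjective x
  exact DFunLike.congr_fun hfh g

theorem toGroupFunction_opfRep (F : ProbabilisticStructure G (G ⧸ H)) (g x : G)
    (f : F.opfSpace) : F.toGroupFunction (F.opfRep g f) x = F.toGroupFunction f (g⁻¹ * x) := rfl

theorem assocRep_apply (F : ProbabilisticStructure G (G ⧸ H)) (g : G) (ω : F.stateSpace)
    (f : F.opfSpace) : F.assocRep g ω f = ω (F.opfRep g⁻¹ f) := rfl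

variable [IsTopologicalGroup G] [CompactSpace G] [MeasurableSpace G] [BorelSpace G]
  (μ : Measure G) [IsFiniteMeasure μ] [μ.IsMulLeftInvariant]

/-- Every subrepresentation of the representation on states is realized by functions in `ℝ[F]`. -/
theorem exists_opfSpace_embedding [μ.IsOpenPosMeasure] (F : ProbabilisticStructure G (G ⧸ H))
    {W : Type*} [AddCommGroup W] [Module ℝ W] {σ : Representation ℝ G W} (h : F.Contains σ) :
    ∃ A : W →ₗ[ℝ] F.opfSpace, Function.Injective A ∧ ∀ g w, A (σ g w) = F.opfRep g (A w) := by
  obtain ⟨T, hT⟩ := h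
  have := F.finiteDimensional
  -- The Gram map of the pairing: injective by definiteness, bijective by dimension, equivariant by
  -- invariance.
  let B : F.opfSpace →ₗ[ℝ] F.stateSpace :=
    (integralPairing μ).compl₁₂ F.toGroupFunction F.toGroupFunction
  have hB : Function.Injective B := by
    rw [injective_iff_map_eq_zero]
    intro f hf
    refine F.toGroupFunction_injective ?_
    rw [map_zero]
    exact eq_zero_of_integralPairing_self μ (LinearMap.congr_fun hf f)
  let e : F.opfSpace ≃ₗ[ℝ] F.stateSpace :=
    LinearEquiv.ofInjectiveOfFinrankEq B hB Subspace.dual_finrank_eq.symm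
  have he : ∀ f, e f = B f := fun _ => rfl
  refine ⟨e.symm.toLinearMap ∘ₗ T.toLinearMap, e.symm.injective.comp hT, fun g w => ?_⟩
  apply e.injective
  ext f
  change e (e.symm (T (σ g w))) f = integralPairing μ _ _
  rw [e.apply_symm_apply, T.isIntertwining, assocRep_apply]
  conv_lhs => rw [← e.apply_symm_apply (T w), he]
  refine (integralPairing_translate μ g (toGroupFunction_opfRep F g · _) fun x => ?_).symm
  simp [toGroupFunction_opfRep]

/-- An irreducible space of continuous functions that does not appear in `F` is orthogonal to
`ℝ[F]`. -/
theorem integralPairing_eq_zero_of_not_contains (F : ProbabilisticStructure G (G ⧸ H))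
    {W : Type*} [AddCommGroup W] [Module ℝ W] {σ : Representation ℝ G W} (hσ : σ.IsIrreducible)
    (A : W →ₗ[ℝ] C(G, ℝ)) (hA : ∀ g w x, A (σ g w) x = A w (g⁻¹ * x)) (h : ¬ F.Contains σ)
    (w : W) (f : F.opfSpace) : integralPairing μ (A w) (F.toGroupFunction f) = 0 := by
  -- Pairing against `A w` is an intertwiner into the dual of `ℝ[F]`; by irreducibility it is
  -- injective, which `h` excludes, or zero.
  let S : Representation.IntertwiningMap σ F.assocRep :=
    LinearMap.intertwiningMap_of_isIntertwiningMap σ F.assocRep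
      ((integralPairing μ).compl₁₂ A F.toGroupFunction) fun g v => by
        ext f
        rw [assocRep_apply]
        refine integralPairing_translate μ g (hA g v) fun x => ?_
        simp [toGroupFunction_opfRep]
  have hS : S = 0 :=
    (Representation.IsIrreducible.injective_or_eq_zero S).resolve_left fun hi => h ⟨S, hi⟩
  exact LinearMap.congr_fun (DFunLike.congr_fun hS w) f

end ProbabilisticStructure

/-! ### The separating OPF and the bound -/

theorem exists_haar_probability (G : Type*) [Group G] [TopologicalSpace G] [IsTopologicalGroup G]
    [CompactSpace G] [T2Space G] [MeasurableSpace G] [BorelSpace G] :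
    ∃ μ : Measure G, μ.IsHaarMeasure ∧ IsProbabilityMeasure μ :=
  ⟨Measure.haarMeasure ⊤, inferInstance, ⟨Measure.haarMeasure_self (K₀ := ⊤)⟩⟩

open ProbabilisticStructure in
/-- If a real irreducible representation of dimension `d` appears in the unrestricted structure
`F₀` but not in `F₁`, then `D(F₀, F₁) ≥ 1 / (2 d)`. -/
theorem one_div_two_mul_finrank_le_operationalDist {G : Type*} [Group G] [TopologicalSpace G]
    [IsTopologicalGroup G] [CompactSpace G] [T2Space G] {H : Subgroup G}
    {F₀ F₁ : ProbabilisticStructure G (G ⧸ H)} (hF₀ : F₀.IsUnrestricted)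
    {W : Type*} [AddCommGroup W] [Module ℝ W] {σ : Representation ℝ G W}
    (hσ : σ.IsIrreducible) (h₀ : F₀.Contains σ) (h₁ : ¬ F₁.Contains σ) :
    1 / (2 * (Module.finrank ℝ W : ℝ)) ≤ operationalDist F₀ F₁ := by
  let : MeasurableSpace G := borel G
  have : BorelSpace G := ⟨rfl⟩
  obtain ⟨μ, _, _⟩ := exists_haar_probability G
  have := F₀.finiteDimensional
  obtain ⟨A, hAinj, hAeq⟩ := F₀.exists_opfSpace_embedding μ h₀
  have : FiniteDimensional ℝ W := FiniteDimensional.of_injective A hAinj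
  have hA : ∀ g w x, (F₀.toGroupFunction ∘ₗ A) (σ g w) x =
      (F₀.toGroupFunction ∘ₗ A) w (g⁻¹ * x) := fun g w x => by
    simp only [LinearMap.comp_apply, hAeq, toGroupFunction_opfRep]
  obtain ⟨κ, hκ, hκ_le⟩ := exists_reproducing_kernel μ σ (F₀.toGroupFunction ∘ₗ A)
    (F₀.toGroupFunction_injective.comp hAinj) hA
  have horth := F₁.integralPairing_eq_zero_of_not_contains μ hσ (F₀.toGroupFunction ∘ₗ A) hA h₁ κ
  simp only [LinearMap.comp_apply] at hκ hκ_le horth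
  -- Otherwise the zero map would embed `W` in the representation of `F₁`.
  have : Nontrivial W := by
    by_contra hW
    rw [not_nontrivial_iff_subsingleton] at hW
    exact h₁ ⟨0, Function.injective_of_subsingleton _⟩
  set d : ℝ := (Module.finrank ℝ W : ℝ) with hd
  have hd0 : 0 < d := Nat.cast_pos.2 Module.finrank_pos
  let u₀ : F₀.opfSpace := ⟨1, F₀.one_mem_opfSpace⟩
  let φ : F₀.opfSpace := d⁻¹ • A κ
  have hφ : ∀ g : G, |F₀.toGroupFunction φ g| ≤ 1 := fun g => by
    simp only [φ, map_smul, ContinuousMap.smul_apply, smul_eq_mul, abs_mul, abs_inv,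
      abs_of_pos hd0]
    rw [inv_mul_le_iff₀ hd0, mul_one]
    exact hκ_le g
  -- The affine map of `[-1, 1]` onto `[0, 1]` applied to `φ`.
  let f₀ : F₀.opfSpace := (2⁻¹ : ℝ) • (u₀ + φ)
  have hf₀ : (f₀ : G ⧸ H → ℝ) ∈ F₀.opf := hF₀.mem_opf f₀.2 fun x => by
    obtain ⟨g, rfl⟩ := QuotientGroup.mk_surjective x
    have h := abs_le.1 (hφ g)
    rw [toGroupFunction_apply] at h
    change (2⁻¹ : ℝ) * (1 + (φ : G ⧸ H → ℝ) g) ∈ Set.Icc (0 : ℝ) 1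
    constructor <;> linarith [h.1, h.2]
  refine le_operationalDist hf₀ fun f₁ hf₁ => ?_
  let u₁ : F₁.opfSpace := ⟨1, F₁.one_mem_opfSpace⟩
  let k₁ : F₁.opfSpace := ⟨f₁, Submodule.subset_span hf₁⟩
  have hu : F₀.toGroupFunction u₀ = F₁.toGroupFunction u₁ := rfl
  -- The unit lies in `ℝ[F₁]` too, so only `⟨φ, φ⟩ / 2 = d / (2 d²)` survives.
  have hpair : integralPairing μ (F₀.toGroupFunction φ)
      (F₀.toGroupFunction f₀ - F₁.toGroupFunction k₁) = 1 / (2 * d) := by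
    simp only [f₀, φ, map_sub, map_add, map_smul, hu, horth, hκ, LinearMap.smul_apply,
      smul_eq_mul]
    field_simp
    ring
  rw [← hpair]
  exact integralPairing_le μ hφ fun g => le_ciSup (bddAbove_opfDist F₀ F₁ hf₀ hf₁) (g : G ⧸ H)

theorem theorem3 {G : Type*} [Group G] [TopologicalSpace G] [IsTopologicalGroup G]
    [CompactSpace G] [T2Space G] (H : Subgroup G) (hH : IsClosed (H : Set G))
    (hGelfand : IsGelfandPair G H)
    (F₀ F₁ : ProbabilisticStructure G (G ⧸ H))
    (hF₀ : F₀.IsUnrestricted) (hF₁ : F₁.IsUnrestricted)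
    {W : Type*} [AddCommGroup W] [Module ℝ W] (σ : Representation ℝ G W)
    (hσ : σ.IsIrreducible) (h₀ : F₀.Contains σ) (h₁ : ¬ F₁.Contains σ) :
    operationalDist F₀ F₁ ≥ 1 / (4 * (Module.finrank ℝ W : ℝ)) := by
  refine le_trans ?_ (one_div_two_mul_finrank_le_operationalDist hF₀ hσ h₀ h₁)
  -- If `finrank` is `0`, both fractions are `0` by the convention for division by zero.
  rcases (Nat.cast_nonneg (α := ℝ) (Module.finrank ℝ W)).eq_or_lt with hd | hd
  · simp [← hd]
  · exact one_div_le_one_div_of_le (by positivity) (by linarith)
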